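/- Consider structural causal models (SCMs) with finitely many endogenous variables $V\in\mathbf V$, each with a finite discrete domain $\Omega_V$, and finitely many mutually independent exogenous variables $U_i\in\mathbf U$ with values in arbitrary measurable spaces; each $V$ is given by a measurable structural function $V\leftarrow f_V(\mathrm{PA}_V,\mathbf U_V)$ with $\mathrm{PA}_V\subseteq\mathbf V$, $\mathbf U_V\subseteq\mathbf U$. The causal graph $\mathcal G$ of the model has nodes $\mathbf V\cup\mathbf U$ and arrows into $V$ from each element of $\mathrm{PA}_V\cup\mathbf U_V$, and it is assumed to be acyclic; $P(\mathbf V)$ denotes the induced observational distribution. A nested regime $R$ sets finitely many endogenous variables, each either to a constant or to the value which that variable itself takes, for the same unit $\mathbf u$, under another nested regime (for instance $Y_{a,W_{a'}}$ is $Y$ when $A$ is set to $a$ and $W$ is set to $W_{a'}(\mathbf u)$); $Y_R(\mathbf u)$ denotes the resulting value of $Y$. A nested counterfactual measure is a real number of the form $$\mu=\sum_{j=1}^m c_j\,P(E_j\mid O_j),$$ where $c_j\in\mathbb R$, each $E_j$ is a finite conjunction of events $Y_R=y$, and each $O_j$ is an event on the observed variables $\mathbf V$ (possibly the sure event); a conditional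 probability given a null event is read as $0$. This includes single probabilities such as $P(Y_{a,W_{a'}}=y\mid a)$ and differences of them such as the counterfactual, direct, indirect and spurious effects. For an exogenous variable $U_i$, let $\mathbf C(U_i)\subseteq\mathbf V$ be the c-component covering $U_i$, that is, the set of endogenous variables which can be reached from a child of $U_i$ by a (possibly trivial) path of bidirected arrows, where $V\leftrightarrow V'$ means that $V$ and $V'$ share an exogenous parent. Let $\mathrm{Pa}(\mathbf C(U_i))$ be the union of $\mathbf C(U_i)$ and the endogenous parents of its elements, and let $$d_i=\prod_{V\in \mathrm{Pa}(\mathbf C(U_i))}|\Omega_V| .$$ Theorem. For every such SCM $\mathcal M$ with causal graph $\mathcal G$ and every nested counterfactual measure $\mu$ there is an SCM $\mathcal N$ with the same endogenous and exogenous variables, the same endogenous domains and the same causal graph $\mathcal G$, in which every exogenous variable $U_i$ is discrete with a finite domain of cardinality at most $d_i+1$, such that $\mathcal M$ and $\mathcal N$ induce the same observational distribution $P(\mathbf V)$ and the same value of $\mu$. -/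

import Mathlib

open MeasureTheory

universe uV uU uD uE

/-- A causal diagram with endogenous nodes `V` and exogenous nodes `U`: `pa v` is the set of
endogenous nodes with an arrow into `v`, `exo v` the set of exogenous nodes with an arrow into `v`.
There are no arrows into exogenous nodes, so acyclicity concerns the endogenous arrows only. -/
structure CausalDiagram (V : Type uV) (U : Type uU) where
  pa : V → Set V
  exo : V → Set U
  acyclic : ∀ v, ¬ Relation.TransGen (fun j i => j ∈ pa i) v v

namespace CausalDiagram

variable {V : Type uV} {U : Type uU} (G : CausalDiagram V U)

theorem wf [Finite V] : WellFounded (fun j i => j ∈ G.pa i) := by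
  have : Std.Irrefl (Relation.TransGen (fun j i => j ∈ G.pa i)) := ⟨G.acyclic⟩
  exact Subrelation.wf (r := Relation.TransGen (fun j i => j ∈ G.pa i))
    (fun hab => Relation.TransGen.single hab) (Finite.wellFounded_of_trans_of_irrefl _)

/-- `v ↔ w`: the two nodes share an exogenous parent. -/
def BiArrow (v w : V) : Prop := ∃ k, k ∈ G.exo v ∧ k ∈ G.exo w

/-- The (maximal) c-component covering the exogenous node `k`: the nodes joined by a bi-directed
path, possibly of length zero, to a child of `k`. Any two children of `k` are joined by a
bi-directed arrow, hence this is one connected component of the bi-directed graph, and it is empty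
if `k` has no child. -/
def cComponent (k : U) : Set V :=
  {v | ∃ w, k ∈ G.exo w ∧ Relation.ReflTransGen G.BiArrow w v}

/-- The c-component covering `k` together with all observed parents of its nodes. -/
def paComponent (k : U) : Set V :=
  {j | j ∈ G.cComponent k ∨ ∃ v ∈ G.cComponent k, j ∈ G.pa v}

open Classical in
/-- The product of the sizes of the domains of the variables in `G.paComponent k`. -/
noncomputable def domProd [Fintype V] (D : V → Type uD) [∀ v, Fintype (D v)] (k : U) : ℕ :=
  ∏ v ∈ Finset.univ.filter (fun v => v ∈ G.paComponent k), Fintype.card (D v)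

end CausalDiagram

/-- A structural causal model with causal diagram `G` and endogenous domains `D v`. The arguments
of the structural function `f v` are exactly those given by the arrows into `v`. The exogenous
variable `k` takes values in an arbitrary measurable space `Exo k` and has law `P k`. Measurability
of `f v` is with respect to the discrete σ-algebra on `D v`. -/
structure SCM {V : Type uV} {U : Type uU} (G : CausalDiagram V U) (D : V → Type uD) where
  Exo : U → Type uE
  mExo : ∀ k, MeasurableSpace (Exo k)
  P : ∀ k, Measure (Exo k)
  prob : ∀ k, IsProbabilityMeasure (P k)
  f : ∀ v : V, (∀ j : G.pa v, D j) → (∀ k : G.exo v, Exo k) → D v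
  meas_f : ∀ (v : V) (p : ∀ j : G.pa v, D j) (a : D v), MeasurableSet {e | f v p e = a}

attribute [instance] SCM.mExo SCM.prob

/-- Nested interventions: starting from no intervention, finitely many variables are set either
to a constant (`setConst R v a`: in addition to `R`, set `v` to `a`) or to the value that the
variable itself takes for the same unit under another such regime (`setNested R v R'`:
in addition to `R`, set `v` to `v_{R'}`). A later setting of the same variable overrides. -/
inductive Regime {V : Type uV} (D : V → Type uD) : Type (max uV uD)
  | observe : Regime D
  | setConst (R : Regime D) (v : V) (a : D v) : Regime D
  | setNested (R : Regime D) (v : V) (R' : Regime D) : Regime D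

/-- The event that the nested counterfactual variable `var_{regime}` equals `val`. -/
structure CtfLiteral {V : Type uV} (D : V → Type uD) where
  regime : Regime D
  var : V
  val : D var

/-- A term `coef * P(event | V ∈ given)`, where `event` is a finite conjunction of
(nested) counterfactual literals and `given` is an event on the observed variables. -/
structure CtfTerm {V : Type uV} (D : V → Type uD) where
  coef : ℝ
  event : List (CtfLiteral D)
  given : Set (∀ v, D v)

/-- Nested counterfactual measures: finite linear combinations of (nested) counterfactual
probabilities, each of them possibly conditioned on an observed event. -/
abbrev NestedMeasure {V : Type uV} (D : V → Type uD) := List (CtfTerm D)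

namespace SCM

variable {V : Type uV} {U : Type uU} {G : CausalDiagram V U} {D : V → Type uD}

/-- The solution, for the unit `u`, of the submodel in which every `v` with `x v = some a` is
set to the constant `a`, the other variables being determined by their structural functions. -/
noncomputable def solve [Finite V] (M : SCM.{uV, uU, uD, uE} G D) (x : ∀ v, Option (D v))
    (u : ∀ k, M.Exo k) : ∀ v, D v :=
  G.wf.fix fun v rec =>
    (x v).getD (M.f v (fun j => rec j.1 j.2) (fun k => u k.1))

theorem solve_eq [Finite V] (M : SCM.{uV, uU, uD, uE} G D) (x : ∀ v, Option (D v))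
    (u : ∀ k, M.Exo k) (v : V) :
    M.solve x u v = (x v).getD (M.f v (fun j => M.solve x u j.1) (fun k => u k.1)) :=
  G.wf.fix_eq _ v

/-- The values to which a nested regime sets variables, for the unit `u`. -/
noncomputable def setting [Finite V] [DecidableEq V] (M : SCM.{uV, uU, uD, uE} G D)
    (u : ∀ k, M.Exo k) : Regime D → ∀ v, Option (D v)
  | .observe => fun _ => none
  | .setConst R v a => Function.update (M.setting u R) v (some a)
  | .setNested R v R' =>
      Function.update (M.setting u R) v (some (M.solve (M.setting u R') u v))

/-- The potential responses of all variables under a nested regime, for the unit `u`. -/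
noncomputable def response [Finite V] [DecidableEq V] (M : SCM.{uV, uU, uD, uE} G D)
    (R : Regime D) (u : ∀ k, M.Exo k) : ∀ v, D v :=
  M.solve (M.setting u R) u

/-- The joint law of the mutually independent exogenous variables. -/
noncomputable def exoLaw [Fintype U] (M : SCM.{uV, uU, uD, uE} G D) :
    Measure (∀ k, M.Exo k) :=
  Measure.pi M.P

/-- The observational distribution `P(V = v)`. -/
noncomputable def obsDist [Finite V] [Fintype U] (M : SCM.{uV, uU, uD, uE} G D)
    (v : ∀ i, D i) : ℝ :=
  M.exoLaw.real {u | M.solve (fun _ => none) u = v}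

/-- `P(event, V ∈ given)`. -/
noncomputable def jointProb [Finite V] [DecidableEq V] [Fintype U]
    (M : SCM.{uV, uU, uD, uE} G D) (event : List (CtfLiteral D)) (given : Set (∀ v, D v)) : ℝ :=
  M.exoLaw.real {u | (∀ l ∈ event, M.response l.regime u l.var = l.val) ∧
    M.solve (fun _ => none) u ∈ given}

/-- `P(event | V ∈ given)`, equal to `0` by convention if `P(V ∈ given) = 0`. -/
noncomputable def condProb [Finite V] [DecidableEq V] [Fintype U]
    (M : SCM.{uV, uU, uD, uE} G D) (event : List (CtfLiteral D)) (given : Set (∀ v, D v)) : ℝ :=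
  M.jointProb event given / M.jointProb [] given

/-- The value of a nested counterfactual measure in the model. -/
noncomputable def value [Finite V] [DecidableEq V] [Fintype U]
    (M : SCM.{uV, uU, uD, uE} G D) (μ : NestedMeasure D) : ℝ :=
  (μ.map fun t => t.coef * M.condProb t.event t.given).sum

end SCM

/-! The exogenous laws are made finite one at a time, the structural functions staying fixed. Fix
`k` and the other laws. No exogenous variable feeds both `C(k)` and its complement, so `P(V = s)` is
a product of two local probabilities (`obsDistUnder_eq_mul`), and the one for the complement ignores
the law of `U_k`. The other depends on `s` only through `Pa(C(k))`: preserving `d_k` numbers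
preserves `P(V)`. All conditioning probabilities are then fixed too, so `μ` is a linear combination
of joint probabilities (`valueUnder_eq_sum`) and adds one number.

Each of these `d_k + 1` numbers is the integral of a function of `U_k` against its law
(`pi_update_real_eq_integral`). The vector of integrals lies in the convex hull of the range of the
integrand, with no closure needed (`integral_mem_convexHull`), so Carathéodory gives a finitely
supported law. The usual extra atom is saved because some of the coordinates sum to one
(`exists_finite_quadrature`). Finally the atoms are relabelled by `Fin n` (`pullback`). -/

/-! ### Convex hulls and finite quadrature -/

theorem exists_ne_zero_forall_le_zero_of_zero_notMem {E : Type*} [NormedAddCommGroup E]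
    [NormedSpace ℝ E] [FiniteDimensional ℝ E] {K : Set E} (hK : Convex ℝ K) (hne : K.Nonempty)
    (h0 : (0 : E) ∉ K) : ∃ f : StrongDual ℝ E, f ≠ 0 ∧ ∀ a ∈ K, f a ≤ 0 := by
  by_cases hint : (interior K).Nonempty
  · obtain ⟨f, hf, h⟩ := geometric_hahn_banach_of_nonempty_interior_point hK
      (fun h => h0 (interior_subset h)) hint
    exact ⟨f, hf, by simpa using h⟩
  -- With empty interior, `K` lies in a proper affine subspace; a functional vanishing on its
  -- direction is constant on `K`, and its sign can be chosen.
  · rw [hK.interior_nonempty_iff_affineSpan_eq_top] at hint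
    have hdir : vectorSpan ℝ K < ⊤ := by
      rw [lt_top_iff_ne_top]
      rwa [← AffineSubspace.direction_eq_top_iff_of_nonempty (hne.affineSpan ℝ),
        direction_affineSpan] at hint
    obtain ⟨g, hg, hle⟩ := Submodule.exists_le_ker_of_lt_top _ hdir
    obtain ⟨b, hb⟩ := hne
    have hconst : ∀ a ∈ K, g a = g b := fun a ha => by
      have := hle (vsub_mem_vectorSpan ℝ ha hb)
      simpa [sub_eq_zero] using this
    have hg' : LinearMap.toContinuousLinearMap g ≠ 0 := by simpa using hg
    rcases le_total (g b) 0 with h | h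
    · exact ⟨LinearMap.toContinuousLinearMap g, hg', fun a ha => by simpa [hconst a ha] using h⟩
    · exact ⟨-LinearMap.toContinuousLinearMap g, neg_ne_zero.2 hg',
        fun a ha => by simpa [hconst a ha] using h⟩

/-- Induction on the dimension: if the hull missed `0`, a functional `f ≤ 0` on it would have `f ∘
F` of mean zero, hence zero almost everywhere, and `F` would live in the smaller space `ker f`. -/
theorem zero_mem_convexHull_of_integral_eq_zero {Ω : Type*} [MeasurableSpace Ω] {P : Measure Ω}
    [IsProbabilityMeasure P] (n : ℕ) : ∀ {E : Type uE} [NormedAddCommGroup E]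
    [NormedSpace ℝ E] [FiniteDimensional ℝ E], Module.finrank ℝ E = n → ∀ {S : Set E} {F : Ω → E},
    Integrable F P → (∀ᵐ a ∂P, F a ∈ S) → ∫ a, F a ∂P = 0 → (0 : E) ∈ convexHull ℝ S := by
  induction n using Nat.strong_induction_on with
  | _ n ih =>
    intro E _ _ _ hn S F hF hS hint
    by_contra h0
    have hne : (convexHull ℝ S).Nonempty := by
      obtain ⟨a, ha⟩ := hS.exists
      exact ⟨F a, subset_convexHull ℝ S ha⟩
    obtain ⟨f, hf, hle⟩ :=
      exists_ne_zero_forall_le_zero_of_zero_notMem (convex_convexHull ℝ S) hne h0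
    have hzero : ∀ᵐ a ∂P, f (F a) = 0 := by
      have hi : ∫ a, -f (F a) ∂P = 0 := by
        rw [integral_neg, f.integral_comp_comm hF, hint, map_zero, neg_zero]
      rw [integral_eq_zero_iff_of_nonneg_ae (f := fun a => -f (F a)) _
        (f.integrable_comp hF).neg] at hi
      · filter_upwards [hi] with a ha
        simpa using ha
      · filter_upwards [hS] with a ha
        simpa using hle _ (subset_convexHull ℝ S ha)
    let W : Submodule ℝ E := LinearMap.ker f.toLinearMap
    have hW : Module.finrank ℝ W < n := by
      rw [← hn]
      refine Submodule.finrank_lt fun h => hf ?_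
      ext x
      simpa [W] using (h ▸ Submodule.mem_top : x ∈ W)
    -- A projection onto `W` makes `F` a `W`-valued function everywhere, changing it only on a null
    -- set.
    obtain ⟨p, hp⟩ := W.subtype.exists_leftInverse_of_injective (by simp)
    have hpW : ∀ x : E, f x = 0 → ((p x : W) : E) = x := fun x hx => by
      have := LinearMap.congr_fun hp (⟨x, hx⟩ : W)
      exact congrArg Subtype.val this
    let p' : E →L[ℝ] W := LinearMap.toContinuousLinearMap p
    have hmem : (0 : W) ∈ convexHull ℝ (W.subtype ⁻¹' S) := by
      refine ih _ hW rfl (p'.integrable_comp hF) ?_ ?_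
      · filter_upwards [hS, hzero] with a ha hz
        simpa [p', hpW _ hz] using ha
      · rw [p'.integral_comp_comm hF, hint, map_zero]
    apply h0
    have h1 : W.subtype 0 ∈ W.subtype '' convexHull ℝ (W.subtype ⁻¹' S) := ⟨0, hmem, rfl⟩
    rw [LinearMap.image_convexHull, map_zero] at h1
    exact convexHull_mono (Set.image_preimage_subset _ _) h1

open scoped Pointwise in
theorem integral_mem_convexHull {Ω : Type*} [MeasurableSpace Ω] {P : Measure Ω}
    [IsProbabilityMeasure P] {E : Type*} [NormedAddCommGroup E] [NormedSpace ℝ E]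
    [FiniteDimensional ℝ E] {S : Set E} {F : Ω → E} (hF : Integrable F P)
    (hS : ∀ᵐ a ∂P, F a ∈ S) : ∫ a, F a ∂P ∈ convexHull ℝ S := by
  set m := ∫ a, F a ∂P with hm
  have h := zero_mem_convexHull_of_integral_eq_zero (P := P) _ rfl (S := -m +ᵥ S)
    (F := fun a => -m + F a) ((integrable_const _).add hF)
    (by filter_upwards [hS] with a ha using Set.vadd_mem_vadd_set ha)
    (by rw [integral_add (integrable_const _) hF]; simp [hm])
  rw [convexHull_vadd, Set.mem_vadd_set] at h
  obtain ⟨x, hx, hx0⟩ := h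
  have : x = m := by
    rw [vadd_eq_add, neg_add_eq_zero] at hx0
    exact hx0.symm
  exact this ▸ hx

/-- Carathéodory gives affinely independent points. As `l = 1` on the range, every linear relation
among them has coefficients summing to zero, so they are even linearly independent; hence the bound
`finrank` rather than `finrank + 1`. -/
theorem exists_finite_quadrature {Ω : Type*} [MeasurableSpace Ω] {P : Measure Ω}
    [IsProbabilityMeasure P] {E : Type*} [NormedAddCommGroup E] [NormedSpace ℝ E]
    [FiniteDimensional ℝ E] {F : Ω → E} (hF : Integrable F P) (l : E →ₗ[ℝ] ℝ)
    (hl : ∀ a, l (F a) = 1) :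
    ∃ n ≤ Module.finrank ℝ E, ∃ (e : Fin n → Ω) (w : Fin n → ℝ), (∀ i, 0 ≤ w i) ∧
      ∑ i, w i = 1 ∧ ∑ i, w i • F (e i) = ∫ a, F a ∂P := by
  obtain ⟨ι, _, z, w, hz, hind, hw, hw1, hwz⟩ := eq_pos_convex_span_of_mem_convexHull
    (integral_mem_convexHull hF (Filter.Eventually.of_forall fun a => Set.mem_range_self a))
  choose e he using fun i => hz (Set.mem_range_self i)
  have hlin : LinearIndependent ℝ z := by
    rw [Fintype.linearIndependent_iff]
    intro g hg
    have hsum : ∑ i, g i = 0 := by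
      have := congrArg l hg
      simpa [← he, hl] using this
    rw [affineIndependent_iff] at hind
    exact fun i => hind Finset.univ g hsum hg i (Finset.mem_univ i)
  let r := (Fintype.equivFin ι).symm
  refine ⟨Fintype.card ι, hlin.fintype_card_le_finrank, e ∘ r, w ∘ r, fun i => (hw _).le, ?_, ?_⟩
  · rw [← hw1]
    exact r.sum_comp w
  · rw [← hwz, ← r.sum_comp]
    simp [he]

/-! ### Product measures: independence and change of one factor -/

theorem isProbabilityMeasure_update {U : Type*} [DecidableEq U] {X : U → Type*}
    [∀ k, MeasurableSpace (X k)] (P : ∀ k, Measure (X k)) [∀ k, IsProbabilityMeasure (P k)]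
    (k : U) (Q : Measure (X k)) [IsProbabilityMeasure Q] (i : U) :
    IsProbabilityMeasure (Function.update P k Q i) := by
  rcases eq_or_ne i k with rfl | h
  · rw [Function.update_self]; infer_instance
  · rw [Function.update_of_ne h]; infer_instance

section Independence

variable {U : Type*} [Fintype U] {X : U → Type*} [∀ k, MeasurableSpace (X k)]

theorem pi_real_comp {Y : U → Type*} [∀ k, MeasurableSpace (Y k)] (e : ∀ k, Y k → X k)
    (he : ∀ k, Measurable (e k)) (Q : ∀ k, Measure (Y k)) [∀ k, IsProbabilityMeasure (Q k)]
    {A : Set (∀ k, X k)} (hA : MeasurableSet A) :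
    (Measure.pi Q).real {u | (fun k => e k (u k)) ∈ A} =
      (Measure.pi fun k => (Q k).map (e k)).real A := by
  have := fun k => Measure.isProbabilityMeasure_map (μ := Q k) (he k).aemeasurable
  have hm : Measurable fun (u : ∀ k, Y k) k => e k (u k) :=
    measurable_pi_lambda _ fun k => (he k).comp (measurable_pi_apply k)
  rw [← Measure.pi_map_pi fun k => (he k).aemeasurable, map_measureReal_apply hm hA]
  rfl

/-- Events that depend on disjoint sets of coordinates are independent under a product measure. -/
theorem pi_real_inter_of_disjoint (P : ∀ k, Measure (X k))
    [∀ k, IsProbabilityMeasure (P k)] {S T : Set U} (hST : Disjoint S T) {A B : Set (∀ i, X i)}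
    (hA : MeasurableSet A) (hB : MeasurableSet B)
    (hAS : ∀ u u', (∀ i ∈ S, u i = u' i) → u ∈ A → u' ∈ A)
    (hBT : ∀ u u', (∀ i ∈ T, u i = u' i) → u ∈ B → u' ∈ B) :
    (Measure.pi P).real (A ∩ B) = (Measure.pi P).real A * (Measure.pi P).real B := by
  classical
  obtain ⟨u₀⟩ : Nonempty (∀ i, X i) := ProbabilityMeasure.nonempty ⟨Measure.pi P, inferInstance⟩
  have hdis : Disjoint S.toFinset T.toFinset := by simpa using hST
  have hi := (ProbabilityTheory.iIndepFun_pi (μ := P) (X := fun i x => x)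
    fun i => aemeasurable_id).indepFun_finset S.toFinset T.toFinset hdis
    fun i => measurable_pi_apply i
  -- Filling the missing coordinates from `u₀` exhibits each event as a preimage under restriction
  -- to its coordinates.
  let r : ∀ R : Finset U, (∀ i : R, X i) → ∀ i, X i :=
    fun R v i => if h : i ∈ R then v ⟨i, h⟩ else u₀ i
  have hr : ∀ R, Measurable (r R) := fun R => by
    rw [measurable_pi_iff]
    intro i
    by_cases h : i ∈ R
    · simpa [r, h] using measurable_pi_apply (⟨i, h⟩ : R)
    · simp [r, h]
  have key : ∀ (R : Set U) (C : Set (∀ i, X i)),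
      (∀ u u', (∀ i ∈ R, u i = u' i) → u ∈ C → u' ∈ C) →
      C = (fun (u : ∀ i, X i) (i : R.toFinset) => u i) ⁻¹' (r R.toFinset ⁻¹' C) := by
    intro R C hC
    ext u
    constructor
    · exact hC _ _ fun i hi => by simp [r, hi]
    · exact hC _ _ fun i hi => by simp [r, hi]
  have := hi.measure_inter_preimage_eq_mul _ _ (hr _ hA) (hr _ hB)
  rw [← key S A hAS, ← key T B hBT] at this
  simp [measureReal_def, this]

end Independence

section SingleCoordinate

variable {U : Type*} [DecidableEq U] {X : U → Type*} [∀ k, MeasurableSpace (X k)]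
  (P : ∀ k, Measure (X k)) [∀ k, IsProbabilityMeasure (P k)]

theorem measurable_update_prod (k : U) :
    Measurable (fun p : X k × (∀ i, X i) => Function.update p.2 k p.1) := by
  rw [measurable_pi_iff]
  intro i
  rcases eq_or_ne i k with rfl | h
  · simpa using measurable_fst
  · simp only [Function.update_of_ne h]
    exact (measurable_pi_apply i).comp measurable_snd

variable [Fintype U]

/-- Coordinate `k` is drawn from `P k` and then overwritten by an independent draw from `Q`, which
avoids splitting the product. -/
theorem pi_update_eq_map (k : U) (Q : Measure (X k)) [IsProbabilityMeasure Q] :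
    Measure.pi (Function.update P k Q) =
      (Q.prod (Measure.pi P)).map (fun p => Function.update p.2 k p.1) := by
  have := isProbabilityMeasure_update P k Q
  refine Measure.pi_eq fun s hs => ?_
  rw [Measure.map_apply (measurable_update_prod k) (.univ_pi hs)]
  have : (fun p : X k × (∀ i, X i) => Function.update p.2 k p.1) ⁻¹' Set.univ.pi s =
      s k ×ˢ Set.univ.pi (Function.update s k Set.univ) := by
    ext ⟨a, u⟩
    simp only [Set.mem_preimage, Set.mem_univ_pi, Set.mem_prod]
    constructor
    · refine fun h => ⟨by simpa using h k, fun i => ?_⟩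
      rcases eq_or_ne i k with rfl | hi
      · simp
      · simpa [hi] using h i
    · rintro ⟨h1, h2⟩ i
      rcases eq_or_ne i k with rfl | hi
      · simpa using h1
      · simpa [hi] using h2 i
  rw [this, Measure.prod_prod, Measure.pi_pi, ← Finset.mul_prod_erase _ _ (Finset.mem_univ k),
    ← Finset.mul_prod_erase _ (fun i => Function.update P k Q i (s i)) (Finset.mem_univ k)]
  simp only [Function.update_self, measure_univ, one_mul]
  congr 1
  refine Finset.prod_congr rfl fun i hi => ?_
  rw [Function.update_of_ne (Finset.ne_of_mem_erase hi),
    Function.update_of_ne (Finset.ne_of_mem_erase hi)]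

theorem measurable_pi_real_update (k : U) {A : Set (∀ i, X i)} (hA : MeasurableSet A) :
    Measurable fun a : X k => (Measure.pi P).real {u | Function.update u k a ∈ A} :=
  (measurable_measure_prodMk_left (measurable_update_prod k hA)).ennreal_toReal

theorem integrable_pi_real_update (k : U) {A : Set (∀ i, X i)} (hA : MeasurableSet A)
    (Q : Measure (X k)) [IsProbabilityMeasure Q] :
    Integrable (fun a : X k => (Measure.pi P).real {u | Function.update u k a ∈ A}) Q :=
  Integrable.of_bound (measurable_pi_real_update P k hA).aestronglyMeasurable 1
    (Filter.Eventually.of_forall fun a => by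
      rw [Real.norm_of_nonneg measureReal_nonneg]; exact measureReal_le_one)

theorem pi_update_real_eq_integral (k : U) (Q : Measure (X k)) [IsProbabilityMeasure Q]
    {A : Set (∀ i, X i)} (hA : MeasurableSet A) :
    (Measure.pi (Function.update P k Q)).real A =
      ∫ a, (Measure.pi P).real {u | Function.update u k a ∈ A} ∂Q := by
  rw [pi_update_eq_map, measureReal_def, Measure.map_apply (measurable_update_prod k) hA,
    Measure.prod_apply (measurable_update_prod k hA)]
  simp only [measureReal_def]
  exact (integral_toReal
    (measurable_measure_prodMk_left (measurable_update_prod k hA)).aemeasurable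
    (Filter.Eventually.of_forall fun a => measure_lt_top _ _)).symm

theorem pi_update_real_of_forall_update_mem (k : U) (Q : Measure (X k)) [IsProbabilityMeasure Q]
    {B : Set (∀ k, X k)} (hB : MeasurableSet B) (h : ∀ u a, Function.update u k a ∈ B ↔ u ∈ B) :
    (Measure.pi (Function.update P k Q)).real B = (Measure.pi P).real B := by
  rw [pi_update_real_eq_integral P k Q hB]
  simp [h]

theorem exists_finite_law_of_pi (k : U) {I T : Type*} [Fintype I] [Fintype T]
    {A : I → Set (∀ i, X i)} (hA : ∀ i, MeasurableSet (A i)) (I₀ : Finset I)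
    (hI₀ : ∀ u, ∃! i, i ∈ I₀ ∧ u ∈ A i)
    {B : T → Set (∀ i, X i)} (hB : ∀ t, MeasurableSet (B t)) (c : T → ℝ) :
    ∃ n ≤ Fintype.card I + 1, ∃ (e : Fin n → X k) (Q : Measure (Fin n)),
      IsProbabilityMeasure Q ∧
      (∀ i, (Measure.pi (Function.update P k (Q.map e))).real (A i) = (Measure.pi P).real (A i)) ∧
      ∑ t, c t * (Measure.pi (Function.update P k (Q.map e))).real (B t) =
        ∑ t, c t * (Measure.pi P).real (B t) := by
  let φ : Set (∀ i, X i) → X k → ℝ := fun C a =>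
    (Measure.pi P).real {u | Function.update u k a ∈ C}
  -- One coordinate for each `A i`, and a single one, `none`, for the whole combination of the `B
  -- t`.
  let F : X k → Option I → ℝ := fun a o => o.elim (∑ t, c t * φ (B t) a) fun i => φ (A i) a
  have hFm : ∀ (ν : Measure (X k)) [IsProbabilityMeasure ν] (o : Option I),
      Integrable (fun a => F a o) ν := fun ν _ o => by
    cases o with
    | none =>
      exact integrable_finsetSum _ fun t _ =>
        (integrable_pi_real_update P k (hB t) ν).const_mul (c t)
    | some i => exact integrable_pi_real_update P k (hA i) ν
  have hF : ∀ (ν : Measure (X k)) [IsProbabilityMeasure ν] (o : Option I),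
      ∫ a, F a o ∂ν = o.elim (∑ t, c t * (Measure.pi (Function.update P k ν)).real (B t))
        fun i => (Measure.pi (Function.update P k ν)).real (A i) := fun ν _ o => by
    cases o with
    | none =>
      change ∫ a, ∑ t, c t * φ (B t) a ∂ν = ∑ t, c t * _
      rw [integral_finsetSum _ fun t _ =>
        (integrable_pi_real_update P k (hB t) ν).const_mul (c t)]
      refine Finset.sum_congr rfl fun t _ => ?_
      rw [integral_const_mul, pi_update_real_eq_integral P k ν (hB t)]
    | some i => exact (pi_update_real_eq_integral P k ν (hA i)).symm
  -- The events indexed by `I₀` partition the space: this is the normalisation needed for the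
  -- quadrature.
  have hone : ∀ a, ∑ i ∈ I₀, F a (some i) = 1 := fun a => by
    simp only [F, Option.elim_some, φ]
    rw [← measureReal_biUnion_finset (h := fun _ _ => measure_ne_top _ _)]
    · rw [← probReal_univ (μ := Measure.pi P)]
      congr 1
      refine Set.eq_univ_of_forall fun u => ?_
      obtain ⟨i, hi, -⟩ := hI₀ (Function.update u k a)
      exact Set.mem_biUnion hi.1 hi.2
    · intro i hi j hj hij
      refine Set.disjoint_left.2 fun u hu hu' => hij ?_
      exact (hI₀ (Function.update u k a)).unique ⟨hi, hu⟩ ⟨hj, hu'⟩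
    · exact fun i _ => measurable_prodMk_left (measurable_update_prod k (hA i))
  let l : (Option I → ℝ) →ₗ[ℝ] ℝ := ∑ i ∈ I₀, LinearMap.proj (some i)
  obtain ⟨n, hn, e, w, hw0, hw1, hw⟩ := exists_finite_quadrature (P := P k) (F := F)
    (Integrable.of_eval fun o => hFm _ o) l (fun a => by simpa [l] using hone a)
  let Q : Measure (Fin n) := ∑ i, ENNReal.ofReal (w i) • Measure.dirac i
  have hQ : IsProbabilityMeasure Q := ⟨by
    simp only [Q, Measure.coe_finsetSum, Finset.sum_apply, Measure.smul_apply, measure_univ,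
      smul_eq_mul, mul_one]
    rw [← ENNReal.ofReal_sum_of_nonneg fun i _ => hw0 i, hw1, ENNReal.ofReal_one]⟩
  have he : Measurable e := measurable_of_finite e
  have hQe : IsProbabilityMeasure (Q.map e) := Measure.isProbabilityMeasure_map he.aemeasurable
  have hint : ∀ o, ∫ a, F a o ∂(Q.map e) = ∫ a, F a o ∂(P k) := fun o => by
    rw [← eval_integral fun o => hFm (P k) o, ← hw,
      integral_map he.aemeasurable (hFm (Q.map e) o).aestronglyMeasurable,
      integral_finsetSum_measure fun i _ => by
        exact (integrable_dirac (by simp)).smul_measure ENNReal.ofReal_ne_top]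
    simp [integral_smul_measure, ENNReal.toReal_ofReal (hw0 _)]
  refine ⟨n, by simpa using hn, e, Q, hQ, fun i => ?_, ?_⟩
  · simpa [hF] using hint (some i)
  · simpa [hF] using hint none

end SingleCoordinate

/-! ### Structural equations, measurability and local events -/

namespace SCM

variable {V : Type uV} {U : Type uU} {G : CausalDiagram V U} {D : V → Type uD}

/-- By acyclicity the structural equations have only one solution, so being the solution is a
conjunction of local conditions. -/
theorem solve_eq_iff [Finite V] (M : SCM.{uV, uU, uD, uE} G D) (x : ∀ v, Option (D v))
    (u : ∀ k, M.Exo k) (s : ∀ v, D v) :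
    M.solve x u = s ↔ ∀ v, (x v).getD (M.f v (fun j => s j.1) (fun k => u k.1)) = s v := by
  constructor
  · rintro rfl v
    exact (M.solve_eq x u v).symm
  · intro h
    funext v
    induction v using G.wf.induction with
    | _ v ih =>
      rw [M.solve_eq, ← h v]
      congr 2
      funext j
      exact ih j.1 j.2

theorem measurableSet_f (M : SCM.{uV, uU, uD, uE} G D) (v : V) (p : ∀ j : G.pa v, D j) (a : D v) :
    MeasurableSet {u : ∀ k, M.Exo k | M.f v p (fun k => u k.1) = a} :=
  (measurable_pi_lambda _ fun k => measurable_pi_apply k.1) (M.meas_f v p a)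

/-- The event that the structural equations of the nodes in `S` hold at the assignment `s`. -/
def localEvent (M : SCM.{uV, uU, uD, uE} G D) (S : Set V) (s : ∀ v, D v) : Set (∀ k, M.Exo k) :=
  {u | ∀ v ∈ S, M.f v (fun j => s j.1) (fun k => u k.1) = s v}

theorem measurableSet_localEvent [Finite V] (M : SCM.{uV, uU, uD, uE} G D) (S : Set V) (s : ∀ v, D v) :
    MeasurableSet (M.localEvent S s) := by
  have : M.localEvent S s = ⋂ v ∈ S, {u | M.f v (fun j => s j.1) (fun k => u k.1) = s v} := by
    ext u; simp [localEvent]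
  rw [this]
  exact .biInter (Set.to_countable S) fun v _ => M.measurableSet_f v _ _

section Measurability

variable [Finite V] [∀ v, Finite (D v)] (M : SCM.{uV, uU, uD, uE} G D)

/-- The intervention `x` may depend on the unit, as nested regimes require. -/
theorem measurableSet_solve {x : (∀ k, M.Exo k) → ∀ v, Option (D v)}
    (hx : ∀ v o, MeasurableSet {u | x u v = o}) (v : V) (a : D v) :
    MeasurableSet {u | M.solve (x u) u v = a} := by
  induction v using G.wf.induction with
  | _ v ih =>
    have : {u | M.solve (x u) u v = a} = {u | x u v = some a} ∪ ({u | x u v = none} ∩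
        ⋃ p : ∀ j : G.pa v, D j, (⋂ j : G.pa v, {u | M.solve (x u) u j.1 = p j}) ∩
          {u | M.f v p (fun k => u k.1) = a}) := by
      ext u
      simp only [Set.mem_ofPred_eq, Set.mem_union, Set.mem_inter_iff, Set.mem_iUnion,
        Set.mem_iInter]
      rw [M.solve_eq]
      cases h : x u v with
      | none =>
        simp only [Option.getD_none, reduceCtorEq, true_and, false_or]
        constructor
        · exact fun h => ⟨_, fun j => rfl, h⟩
        · rintro ⟨p, hp, h⟩
          rwa [funext hp]
      | some b => simp
    rw [this]
    exact (hx _ _).union ((hx _ _).inter (.iUnion fun p =>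
      (MeasurableSet.iInter fun j : G.pa v => ih j.1 j.2 _).inter (M.measurableSet_f v p a)))

theorem measurableSet_setting [DecidableEq V] (R : Regime D) (v : V) (o : Option (D v)) :
    MeasurableSet {u | M.setting u R v = o} := by
  induction R generalizing v with
  | observe => simp [setting]
  | setConst R w a ih =>
    rcases eq_or_ne v w with rfl | h
    · simp [setting]
    · simpa [setting, h] using ih v o
  | setNested R w R' ih ih' =>
    rcases eq_or_ne v w with rfl | h
    · cases o with
      | none => simp [setting]
      | some a => simpa [setting] using M.measurableSet_solve ih' v a
    · simpa [setting, h] using ih v o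

theorem measurableSet_solve_none_mem (O : Set (∀ v, D v)) :
    MeasurableSet {u | M.solve (fun _ => none) u ∈ O} := by
  have : {u | M.solve (fun _ => none) u ∈ O} =
      ⋃ s ∈ O, ⋂ v, {u | M.solve (fun _ => none) u v = s v} := by
    ext u
    simp only [Set.mem_ofPred_eq, Set.mem_iUnion, Set.mem_iInter, ← funext_iff, exists_prop,
      exists_eq_right']
  rw [this]
  exact .biUnion (Set.to_countable O) fun s _ => .iInter fun v =>
    M.measurableSet_solve (x := fun _ _ => none) (fun _ _ => .const _) v _

/-- The event that `event` holds and the observed variables lie in `given`. -/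
def jointEvent [DecidableEq V] (event : List (CtfLiteral D)) (given : Set (∀ v, D v)) :
    Set (∀ k, M.Exo k) :=
  {u | (∀ l ∈ event, M.response l.regime u l.var = l.val) ∧
    M.solve (fun _ => none) u ∈ given}

theorem measurableSet_jointEvent [DecidableEq V] (event : List (CtfLiteral D))
    (given : Set (∀ v, D v)) : MeasurableSet (M.jointEvent event given) := by
  have : M.jointEvent event given =
      (⋂ l ∈ {l | l ∈ event}, {u | M.response l.regime u l.var = l.val}) ∩
        {u | M.solve (fun _ => none) u ∈ given} := by
    ext u; simp [jointEvent]
  rw [this]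
  exact (event.finite_toSet.measurableSet_biInter fun l _ =>
    M.measurableSet_solve (M.measurableSet_setting l.regime) _ _).inter
      (M.measurableSet_solve_none_mem given)

end Measurability

theorem setOf_solve_none_eq [Finite V] (M : SCM.{uV, uU, uD, uE} G D) (S : Set V)
    (s : ∀ v, D v) :
    {u | M.solve (fun _ => none) u = s} = M.localEvent S s ∩ M.localEvent Sᶜ s := by
  ext u
  simp only [Set.mem_ofPred_eq, solve_eq_iff, Option.getD_none, localEvent, Set.mem_inter_iff,
    Set.mem_compl_iff]
  constructor
  · exact fun h => ⟨fun v _ => h v, fun v _ => h v⟩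
  · exact fun h v => (em (v ∈ S)).elim (h.1 v) (h.2 v)

theorem localEvent_congr (M : SCM.{uV, uU, uD, uE} G D) {S : Set V} {s s' : ∀ v, D v}
    (h : ∀ v, (v ∈ S ∨ ∃ w ∈ S, v ∈ G.pa w) → s v = s' v) :
    M.localEvent S s = M.localEvent S s' := by
  ext u
  refine forall₂_congr fun v hv => ?_
  rw [h v (Or.inl hv), show (fun j : G.pa v => s j.1) = fun j : G.pa v => s' j.1 from
    funext fun j => h j.1 (Or.inr ⟨v, hv, j.2⟩)]

theorem mem_localEvent_of_eq (M : SCM.{uV, uU, uD, uE} G D) {S : Set V} {s : ∀ v, D v}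
    {u u' : ∀ k, M.Exo k} (h : ∀ k ∈ {k | ∃ v ∈ S, k ∈ G.exo v}, u k = u' k)
    (hu : u ∈ M.localEvent S s) : u' ∈ M.localEvent S s := by
  intro v hv
  rw [← hu v hv]
  congr 1
  funext k
  exact (h k.1 ⟨v, hv, k.2⟩).symm

end SCM

/-! ### Combinatorics of c-components -/

namespace CausalDiagram

variable {V : Type uV} {U : Type uU} (G : CausalDiagram V U)

theorem mem_cComponent_of_mem_exo {k : U} {v : V} (h : k ∈ G.exo v) : v ∈ G.cComponent k :=
  ⟨v, h, .refl⟩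

/-- A common exogenous parent would be a bidirected arrow leaving the component. -/
theorem disjoint_exo_cComponent (k : U) :
    Disjoint {i | ∃ v ∈ G.cComponent k, i ∈ G.exo v} {i | ∃ v ∈ (G.cComponent k)ᶜ, i ∈ G.exo v} := by
  rw [Set.disjoint_left]
  rintro i ⟨v, ⟨w, hw, hwv⟩, hv⟩ ⟨v', hv', hi⟩
  exact hv' ⟨w, hw, hwv.tail ⟨i, hv, hi⟩⟩

theorem card_pi_paComponent [Fintype V] (D : V → Type uD) [∀ v, Fintype (D v)] (k : U) :
    Nat.card (∀ j : G.paComponent k, D j) = G.domProd D k := by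
  classical
  rw [Nat.card_eq_fintype_card, Fintype.card_pi, domProd]
  exact (Finset.prod_subtype _ (by simp) fun v => Fintype.card (D v)).symm

end CausalDiagram

/-! ### Replacing the exogenous laws -/

namespace SCM

variable {V : Type uV} [Fintype V] {U : Type uU} [Fintype U] {D : V → Type uD}
  {G : CausalDiagram V U} (M : SCM.{uV, uU, uD, uE} G D)

/-- The value of a nested counterfactual measure if the exogenous laws are replaced by `P`. -/
noncomputable def valueUnder [DecidableEq V] (P : ∀ k, Measure (M.Exo k)) (μ : NestedMeasure D) :
    ℝ :=
  (μ.map fun t => t.coef * ((Measure.pi P).real (M.jointEvent t.event t.given) /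
    (Measure.pi P).real (M.jointEvent [] t.given))).sum

/-- The observational distribution if the exogenous laws are replaced by `P`. -/
noncomputable def obsDistUnder (P : ∀ k, Measure (M.Exo k)) (s : ∀ v, D v) : ℝ :=
  (Measure.pi P).real {u | M.solve (fun _ => none) u = s}

theorem obsDistUnder_eq_mul (P : ∀ k, Measure (M.Exo k)) [∀ k, IsProbabilityMeasure (P k)]
    (k : U) (s : ∀ v, D v) :
    M.obsDistUnder P s = (Measure.pi P).real (M.localEvent (G.cComponent k) s) *
      (Measure.pi P).real (M.localEvent (G.cComponent k)ᶜ s) := by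
  classical
  rw [obsDistUnder, M.setOf_solve_none_eq (G.cComponent k) s]
  exact pi_real_inter_of_disjoint P (G.disjoint_exo_cComponent k)
    (M.measurableSet_localEvent _ s) (M.measurableSet_localEvent _ s)
    (fun _ _ => M.mem_localEvent_of_eq) (fun _ _ => M.mem_localEvent_of_eq)

/-- All children of `k` lie in its component, so the factor of the complement does not involve
coordinate `k`. -/
theorem obsDistUnder_update_eq [DecidableEq U] (P : ∀ k, Measure (M.Exo k))
    [∀ k, IsProbabilityMeasure (P k)] (k : U) (Q : Measure (M.Exo k)) [IsProbabilityMeasure Q]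
    (s : ∀ v, D v)
    (h : (Measure.pi (Function.update P k Q)).real (M.localEvent (G.cComponent k) s) =
      (Measure.pi P).real (M.localEvent (G.cComponent k) s)) :
    M.obsDistUnder (Function.update P k Q) s = M.obsDistUnder P s := by
  have := isProbabilityMeasure_update P k Q
  rw [obsDistUnder_eq_mul _ _ k, obsDistUnder_eq_mul _ _ k, h,
    pi_update_real_of_forall_update_mem P k Q (M.measurableSet_localEvent _ s)]
  have key : ∀ (u : ∀ k, M.Exo k) (a : M.Exo k), ∀ i ∈ {i | ∃ v ∈ (G.cComponent k)ᶜ, i ∈ G.exo v},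
      Function.update u k a i = u i := by
    rintro u a i ⟨v, hv, hi⟩
    refine Function.update_of_ne ?_ _ _
    rintro rfl
    exact hv (G.mem_cComponent_of_mem_exo hi)
  exact fun u a => ⟨M.mem_localEvent_of_eq (key u a),
    M.mem_localEvent_of_eq fun i hi => (key u a i hi).symm⟩

variable [∀ v, Fintype (D v)]

theorem pi_real_jointEvent_nil [DecidableEq V] (P : ∀ k, Measure (M.Exo k))
    [∀ k, IsProbabilityMeasure (P k)] (O : Set (∀ v, D v)) :
    (Measure.pi P).real (M.jointEvent [] O) = ∑ s ∈ O.toFinite.toFinset, M.obsDistUnder P s := by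
  have : M.jointEvent [] O =
      ⋃ s ∈ O.toFinite.toFinset, {u | M.solve (fun _ => none) u = s} := by
    ext u; simp [jointEvent]
  rw [this, measureReal_biUnion_finset (h := fun _ _ => measure_ne_top _ _)]
  · rfl
  · exact fun s _ s' _ hs => Set.disjoint_left.2 fun u hu hu' => hs (hu.symm.trans hu')
  · exact fun s _ => M.measurableSet_solve_none_mem {s}

/-- The denominators are observational, hence can be computed under `P`; what remains is linear in
the joint probabilities under `P'`. -/
theorem valueUnder_eq_sum [DecidableEq V] {P P' : ∀ k, Measure (M.Exo k)}
    [∀ k, IsProbabilityMeasure (P k)] [∀ k, IsProbabilityMeasure (P' k)]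
    (h : ∀ s, M.obsDistUnder P' s = M.obsDistUnder P s) (μ : NestedMeasure D) :
    M.valueUnder P' μ = ∑ t : Fin μ.length,
      (μ[t].coef / (Measure.pi P).real (M.jointEvent [] μ[t].given)) *
        (Measure.pi P').real (M.jointEvent μ[t].event μ[t].given) := by
  have hO : ∀ O, (Measure.pi P').real (M.jointEvent [] O) =
      (Measure.pi P).real (M.jointEvent [] O) := fun O => by
    simp only [pi_real_jointEvent_nil, h]
  rw [valueUnder, ← Fin.sum_univ_fun_getElem]
  refine Finset.sum_congr rfl fun t _ => ?_
  simp only [hO, Fin.getElem_fin]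
  ring

/-- The law of a single exogenous variable can be replaced by a law with at most `d + 1` atoms. -/
theorem exists_finite_law [DecidableEq V] [DecidableEq U] (P : ∀ k, Measure (M.Exo k))
    [∀ k, IsProbabilityMeasure (P k)] (μ : NestedMeasure D) (k : U) :
    ∃ n ≤ G.domProd D k + 1, ∃ (e : Fin n → M.Exo k) (Q : Measure (Fin n)),
      IsProbabilityMeasure Q ∧
      (∀ s, M.obsDistUnder (Function.update P k (Q.map e)) s = M.obsDistUnder P s) ∧
      M.valueUnder (Function.update P k (Q.map e)) μ = M.valueUnder P μ := by
  classical
  obtain ⟨u₀⟩ : Nonempty (∀ i, M.Exo i) := ProbabilityMeasure.nonempty ⟨Measure.pi P, inferInstance⟩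
  -- A reference assignment; taking it from a unit shows that the domains are inhabited.
  let s₀ : ∀ v, D v := M.solve (fun _ => none) u₀
  let ext : (∀ j : G.paComponent k, D j) → ∀ v, D v := fun w v =>
    if h : v ∈ G.paComponent k then w ⟨v, h⟩ else s₀ v
  let rst : (∀ v, D v) → ∀ j : G.paComponent k, D j := fun s j => s j.1
  have ext_of_mem : ∀ w v (h : v ∈ G.paComponent k), ext w v = w ⟨v, h⟩ := fun w v h => by
    simp [ext, h]
  have ext_of_notMem : ∀ w v, v ∉ G.paComponent k → ext w v = s₀ v := fun w v h => by
    simp [ext, h]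
  have mem_pa : ∀ v ∈ G.cComponent k, v ∈ G.paComponent k := fun v h => Or.inl h
  -- Freeze the parents outside the component at `s₀`. For each unit the submodel with everything
  -- outside the component set to `s₀` has one solution, so exactly one such `w` satisfies the local
  -- equations.
  let I₀ : Finset (∀ j : G.paComponent k, D j) :=
    Finset.univ.filter fun w => ∀ j : G.paComponent k, j.1 ∉ G.cComponent k → w j = s₀ j
  have hI₀ : ∀ u, ∃! w, w ∈ I₀ ∧ u ∈ M.localEvent (G.cComponent k) (ext w) := by
    intro u
    let x : ∀ v, Option (D v) := fun v => if v ∈ G.cComponent k then none else some (s₀ v)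
    have key : ∀ s : ∀ v, D v, M.solve x u = s ↔
        (∀ v ∉ G.cComponent k, s v = s₀ v) ∧ u ∈ M.localEvent (G.cComponent k) s := by
      intro s
      rw [solve_eq_iff]
      constructor
      · refine fun h => ⟨fun v hv => ?_, fun v hv => ?_⟩
        · simpa [x, hv] using (h v).symm
        · simpa [x, hv] using h v
      · rintro ⟨h1, h2⟩ v
        by_cases hv : v ∈ G.cComponent k
        · simpa [x, hv] using h2 v hv
        · simpa [x, hv] using (h1 v hv).symm
    obtain ⟨h1, h2⟩ := (key _).1 rfl
    have hext : ext (rst (M.solve x u)) = M.solve x u := by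
      funext v
      by_cases hv : v ∈ G.paComponent k
      · exact ext_of_mem _ v hv
      · rw [ext_of_notMem _ _ hv, h1 v fun h => hv (mem_pa v h)]
    refine ⟨rst (M.solve x u), ⟨by simpa [I₀] using fun j _ => h1 j, ?_⟩, ?_⟩
    · rwa [hext]
    · rintro w ⟨hw, hu⟩
      have hw' : M.solve x u = ext w := by
        refine (key _).2 ⟨fun v hv => ?_, hu⟩
        by_cases hvp : v ∈ G.paComponent k
        · rw [ext_of_mem w v hvp]
          exact (Finset.mem_filter.1 hw).2 ⟨v, hvp⟩ hv
        · exact ext_of_notMem _ _ hvp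
      funext j
      rw [hw']
      exact (ext_of_mem _ _ j.2).symm
  obtain ⟨n, hn, e, Q, hQ, hA, hB⟩ := exists_finite_law_of_pi P k
    (fun w => M.measurableSet_localEvent (G.cComponent k) (ext w)) I₀ hI₀
    (fun t : Fin μ.length => M.measurableSet_jointEvent μ[t].event μ[t].given)
    (fun t => μ[t].coef / (Measure.pi P).real (M.jointEvent [] μ[t].given))
  rw [← Nat.card_eq_fintype_card, G.card_pi_paComponent] at hn
  have : IsProbabilityMeasure (Q.map e) :=
    Measure.isProbabilityMeasure_map (measurable_of_finite e).aemeasurable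
  have hobs : ∀ s, M.obsDistUnder (Function.update P k (Q.map e)) s = M.obsDistUnder P s := by
    refine fun s => M.obsDistUnder_update_eq P k _ s ?_
    -- Only the values of `s` on the component and its parents matter, so the preserved numbers
    -- cover every `s`.
    rw [M.localEvent_congr (s' := ext (rst s)) fun v hv => (ext_of_mem (rst s) v hv).symm]
    exact hA _
  have := isProbabilityMeasure_update P k (Q.map e)
  exact ⟨n, hn, e, Q, hQ, hobs, by
    rw [M.valueUnder_eq_sum hobs, M.valueUnder_eq_sum (P := P) fun _ => rfl, hB]⟩

/-- Replacing one law leaves the others untouched, so the one-variable result iterates over `S`; all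
laws stay on the original spaces `M.Exo k`. -/
theorem exists_finite_laws [DecidableEq V] (μ : NestedMeasure D) (S : Finset U) :
    ∃ P : ∀ k, Measure (M.Exo k), (∀ k, IsProbabilityMeasure (P k)) ∧
      (∀ k ∈ S, ∃ n ≤ G.domProd D k + 1, ∃ (e : Fin n → M.Exo k) (Q : Measure (Fin n)),
        IsProbabilityMeasure Q ∧ P k = Q.map e) ∧
      (∀ s, M.obsDistUnder P s = M.obsDist s) ∧ M.valueUnder P μ = M.value μ := by
  classical
  induction S using Finset.induction_on with
  | empty => exact ⟨M.P, M.prob, by simp, fun _ => rfl, rfl⟩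
  | insert k S hk ih =>
    obtain ⟨P, hP, hS, hobs, hval⟩ := ih
    obtain ⟨n, hn, e, Q, hQ, hobs', hval'⟩ := M.exists_finite_law P μ k
    have : IsProbabilityMeasure (Q.map e) :=
      Measure.isProbabilityMeasure_map (measurable_of_finite e).aemeasurable
    refine ⟨Function.update P k (Q.map e), isProbabilityMeasure_update P k _, fun i hi => ?_,
      fun s => (hobs' s).trans (hobs s), hval'.trans hval⟩
    rcases Finset.mem_insert.1 hi with rfl | hiS
    · exact ⟨n, hn, e, Q, hQ, Function.update_self ..⟩
    · obtain ⟨n, hn, e, Q, hQ, h⟩ := hS i hiS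
      refine ⟨n, hn, e, Q, hQ, ?_⟩
      rwa [Function.update_of_ne]
      rintro rfl
      exact hk hiS

end SCM

/-! ### Transport to finite exogenous domains -/

namespace SCM

variable {V : Type uV} {U : Type uU} {D : V → Type uD} {G : CausalDiagram V U}

/-- The model in which the exogenous variable `k` takes values in `X k` with law `Q k`, and acts
through `e k`. -/
def pullback (M : SCM.{uV, uU, uD, uE} G D) {X : U → Type*} [mX : ∀ k, MeasurableSpace (X k)]
    (e : ∀ k, X k → M.Exo k) (he : ∀ k, Measurable (e k)) (Q : ∀ k, Measure (X k))
    [hQ : ∀ k, IsProbabilityMeasure (Q k)] : SCM G D where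
  Exo := X
  mExo := mX
  P := Q
  prob := hQ
  f v p x := M.f v p fun k => e k (x k)
  meas_f v p a := by
    have : Measurable fun (x : ∀ k : G.exo v, X k) (k : G.exo v) => e k (x k) :=
      measurable_pi_lambda _ fun k => (he k).comp (measurable_pi_apply k)
    exact this (M.meas_f v p a)

variable (M : SCM.{uV, uU, uD, uE} G D) {X : U → Type*} [mX : ∀ k, MeasurableSpace (X k)]
    (e : ∀ k, X k → M.Exo k) (he : ∀ k, Measurable (e k)) (Q : ∀ k, Measure (X k))
    [hQ : ∀ k, IsProbabilityMeasure (Q k)]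

theorem pullback_solve [Finite V] (x : ∀ v, Option (D v)) (u : ∀ k, X k) :
    (M.pullback e he Q).solve x u = M.solve x fun k => e k (u k) := rfl

theorem pullback_setting [Finite V] [DecidableEq V] (R : Regime D) (u : ∀ k, X k) :
    (M.pullback e he Q).setting u R = M.setting (fun k => e k (u k)) R := by
  induction R with
  | observe => rfl
  | setConst R v a ih => simp only [setting, ih]
  | setNested R v R' ih ih' => simp only [setting, ih, ih', pullback_solve]

theorem pullback_response [Finite V] [DecidableEq V] (R : Regime D) (u : ∀ k, X k) :
    (M.pullback e he Q).response R u = M.response R fun k => e k (u k) := by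
  simp only [response, pullback_setting, pullback_solve]

variable [Fintype V] [Fintype U] [∀ v, Fintype (D v)]

theorem pullback_obsDist (s : ∀ v, D v) :
    (M.pullback e he Q).obsDist s = M.obsDistUnder (fun k => (Q k).map (e k)) s :=
  pi_real_comp e he Q (M.measurableSet_solve_none_mem {s})

theorem pullback_jointProb [DecidableEq V] (event : List (CtfLiteral D))
    (given : Set (∀ v, D v)) : (M.pullback e he Q).jointProb event given =
      (Measure.pi fun k => (Q k).map (e k)).real (M.jointEvent event given) := by
  rw [← pi_real_comp e he Q (M.measurableSet_jointEvent event given)]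
  change (Measure.pi Q).real _ = _
  congr 1
  ext u
  refine and_congr (forall₂_congr fun l _ => ?_) Iff.rfl
  exact iff_of_eq (congrArg (fun s : ∀ v, D v => s l.var = l.val)
    (M.pullback_response e he Q l.regime u))

theorem pullback_value [DecidableEq V] (μ : NestedMeasure D) :
    (M.pullback e he Q).value μ = M.valueUnder (fun k => (Q k).map (e k)) μ := by
  simp only [value, condProb, pullback_jointProb, valueUnder]

end SCM

/-! ### The main theorem -/

theorem theorem1 {V : Type uV} [Fintype V] [DecidableEq V] {U : Type uU} [Fintype U]
    (D : V → Type uD) [∀ v, Fintype (D v)] (G : CausalDiagram V U)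
    (M : SCM.{uV, uU, uD, uE} G D) (μ : NestedMeasure D) :
    ∃ N : SCM.{uV, uU, uD, 0} G D,
      (∀ k, Finite (N.Exo k) ∧ MeasurableSingletonClass (N.Exo k) ∧
        Nat.card (N.Exo k) ≤ G.domProd D k + 1) ∧
      (∀ v, N.obsDist v = M.obsDist v) ∧
      N.value μ = M.value μ := by
  obtain ⟨P, _, hP, hobs, hval⟩ := M.exists_finite_laws μ Finset.univ
  choose n hn e Q hQ hPQ using fun k => hP k (Finset.mem_univ k)
  obtain rfl : P = fun k => (Q k).map (e k) := funext hPQ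
  refine ⟨M.pullback e (fun k => measurable_of_finite (e k)) Q, fun k => ⟨?_, ?_, ?_⟩,
    fun v => ?_, ?_⟩
  · exact inferInstanceAs (Finite (Fin (n k)))
  · exact inferInstanceAs (MeasurableSingletonClass (Fin (n k)))
  · exact (Nat.card_fin (n k)).trans_le (hn k)
  · rw [SCM.pullback_obsDist, hobs]
  · rw [SCM.pullback_value, hval]
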